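/- For a finite graph $H$, the induced Ramsey number $r_{ind}(H)$ is the smallest natural number $N$ for which there is a graph $G$ on $N$ vertices such that every two-coloring of the edges of $G$ contains an induced copy of $H$ (an induced subgraph of $G$ isomorphic to $H$) all of whose edges have the same color. There exists an absolute constant $c$ such that, for every $n$ and every graph $H$ on $n$ vertices, such an $N$ exists and \[ r_{ind}(H) \le 2^{c\, n \log n}, \] where $\log$ denotes the logarithm to base $2$ (and $n\log n$ is read as $0$ for $n=0$). -/

import Mathlib

/-- The graph `G` has the induced Ramsey property for `H`: in every two-coloring of the edges of
`G` there is an induced copy of `H` (a graph embedding `H ↪g G` preserves both adjacency and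
non-adjacency) all of whose edges have the same color. -/
def IsInducedRamsey {V W : Type*} (H : SimpleGraph V) (G : SimpleGraph W) : Prop :=
  ∀ χ : G.EdgeLabeling (Fin 2), ∃ f : H ↪g G, ∃ q : Fin 2,
    ∀ (u v : V) (h : H.Adj u v), χ.get (f u) (f v) (f.map_adj_iff.mpr h) = q

/-- The set of all `N` for which some graph on `N` vertices has the induced Ramsey property
for `H`. -/
def inducedRamseySet {V : Type*} (H : SimpleGraph V) : Set ℕ :=
  {N : ℕ | ∃ G : SimpleGraph (Fin N), IsInducedRamsey H G}

/-- The induced Ramsey number of `H`: the least number of vertices of a graph that has the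
induced Ramsey property for `H`. -/
noncomputable def inducedRamseyNumber {V : Type*} (H : SimpleGraph V) : ℕ :=
  sInf (inducedRamseySet H)

/-! The host is the graph of a Sylvester–Hadamard matrix on `2 ^ O(n log n)` vertices. Only
orthogonality is used: all but few vertices split a given set almost in half. Given a colouring,
call its two classes `R` and `B`.

If a set is not hereditarily `R`-dense, it contains large `X` and `Y` such that every vertex of `X`
has few `R`-neighbours in `Y`. A `B`-system found in `X`, preceded by one found among the vertices
of `Y` with few `R`-neighbours in its sets, is a `B`-system of twice the length
(`hasBlockSystem_or_double`). Doubling the two colours alternately, the costs `ρ⁻¹ ^ (3 * 2 ^ a)`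
form a geometric progression in the exponent; with `ρ` of order `n⁻²` the total is `2 ^ O(n log n)`
(`hasBlockSystem_or`).

Inside an `R`-system the pattern is embedded greedily (`Candidates.exists_next`). A non-edge keeps
about half of the candidates. An edge inside a block keeps a fraction of about `ρ`, by density. An
edge to a later block keeps about half, since few host neighbours there are `B`-neighbours. So
powers of `ρ` are lost only within a block, which the size condition anticipates. Sparsity survives
because a typical vertex also halves the `B`-neighbourhoods of most candidates. -/

open Finset
open scoped Classical

/-! ### The pseudo-random host -/

/-- There is a symmetric Hadamard matrix of every order `2 ^ K`. -/
lemma exists_hadamard (K : ℕ) : ∃ s : Fin (2 ^ K) → Fin (2 ^ K) → ℝ,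
    (∀ x y, s x y = s y x) ∧ (∀ x y, s x y = 1 ∨ s x y = -1) ∧
    ∀ y z, ∑ v, s v y * s v z = if y = z then (2 : ℝ) ^ K else 0 := by
  have hc : Fintype.card (Finset (Fin K)) = 2 ^ K := by simp
  let e : Fin (2 ^ K) ≃ Finset (Fin K) := (Fintype.equivFinOfCardEq hc).symm
  have key : ∀ v y : Finset (Fin K),
      (-1 : ℝ) ^ #(v ∩ y) = ∏ i ∈ v, (if i ∈ y then (-1 : ℝ) else 1) := by
    intro v y
    rw [Finset.prod_ite, Finset.prod_const, Finset.prod_const_one, mul_one, Finset.filter_mem_eq_inter]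
  refine ⟨fun x y => (-1) ^ #(e x ∩ e y), fun x y => by simp only [Finset.inter_comm],
    fun x y => neg_one_pow_eq_or ℝ _, fun y z => ?_⟩
  have h1 : ∑ v, (-1 : ℝ) ^ #(e v ∩ e y) * (-1) ^ #(e v ∩ e z)
      = ∑ v : Finset (Fin K), (-1 : ℝ) ^ #(v ∩ e y) * (-1) ^ #(v ∩ e z) :=
    Equiv.sum_comp e (fun v => (-1 : ℝ) ^ #(v ∩ e y) * (-1) ^ #(v ∩ e z))
  rw [h1]
  simp only [key, ← Finset.prod_mul_distrib]
  -- The sum over all subsets factors over coordinates into terms `1 ± 1`; a coordinate separating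
  -- `e y` from `e z` contributes 0.
  rw [← Finset.powerset_univ, ← Finset.prod_one_add]
  split_ifs with h
  · subst h
    rw [Finset.prod_congr rfl (g := fun _ => (2 : ℝ))]
    · simp
    · intro i _
      split_ifs <;> norm_num
  · have hne : e y ≠ e z := fun h' => h (e.injective h')
    obtain ⟨i, hi⟩ : ∃ i, ¬ (i ∈ e y ↔ i ∈ e z) := by
      by_contra hcon
      push Not at hcon
      exact hne (Finset.ext hcon)
    refine Finset.prod_eq_zero (Finset.mem_univ i) ?_
    by_cases h1 : i ∈ e y <;> by_cases h2 : i ∈ e z <;> simp_all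

/-- Every set `Z` is split almost evenly by the neighbourhoods (with loops) of all but few vertices. -/
def HasSecondMoment {V : Type*} [Fintype V] (P : V → V → Prop) : Prop :=
  ∀ (Z : Finset V) (a : ℝ), 0 < a →
    (#{v : V | a ≤ |(#{y ∈ Z | P v y} : ℝ) - #Z / 2|} : ℝ) * a ^ 2 ≤ Fintype.card V * #Z

/-- Chebyshev's inequality: by orthogonality of the columns, the squares of the row sums over `Z`
add up to `|V| * |Z|`. -/
lemma hasSecondMoment_of_hadamard {V : Type*} [Fintype V] (s : V → V → ℝ)
    (h1 : ∀ x y, s x y = 1 ∨ s x y = -1)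
    (h2 : ∀ y z, ∑ v, s v y * s v z = if y = z then (Fintype.card V : ℝ) else 0) :
    HasSecondMoment fun v y => s v y = -1 := by
  intro Z a ha
  have hsum : ∑ v, (∑ y ∈ Z, s v y) ^ 2 = Fintype.card V * #Z := by
    calc ∑ v, (∑ y ∈ Z, s v y) ^ 2 = ∑ v, ∑ y ∈ Z, ∑ z ∈ Z, s v y * s v z := by
          refine Finset.sum_congr rfl fun v _ => ?_
          rw [sq, Finset.sum_mul_sum]
      _ = ∑ y ∈ Z, ∑ z ∈ Z, ∑ v, s v y * s v z := by
          rw [Finset.sum_comm]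
          exact Finset.sum_congr rfl fun y _ => Finset.sum_comm
      _ = Fintype.card V * #Z := by
          simp only [h2]
          rw [Finset.sum_congr rfl (g := fun _ => (Fintype.card V : ℝ))]
          · simp [mul_comm]
          · intro y hy
            simp [hy]
  have hdev : ∀ v, ∑ y ∈ Z, s v y = -2 * ((#{y ∈ Z | s v y = -1} : ℝ) - #Z / 2) := by
    intro v
    have : ∀ y, s v y = 1 - 2 * (if s v y = -1 then 1 else 0) := by
      intro y
      rcases h1 v y with h | h <;> rw [h] <;> norm_num
    rw [Finset.sum_congr rfl fun y _ => this y, Finset.sum_sub_distrib, ← Finset.mul_sum,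
      Finset.sum_boole]
    simp
    ring
  rw [← hsum, ← nsmul_eq_mul]
  refine (Finset.card_nsmul_le_sum _ (fun v => (∑ y ∈ Z, s v y) ^ 2) _ ?_).trans
    (Finset.sum_le_sum_of_subset_of_nonneg (Finset.subset_univ _) fun _ _ _ => sq_nonneg _)
  intro v hv
  rw [Finset.mem_filter] at hv
  rw [hdev, mul_pow, ← sq_abs ((#{y ∈ Z | s v y = -1} : ℝ) - #Z / 2)]
  nlinarith [pow_le_pow_left₀ ha.le hv.2 2, sq_nonneg a]

/-! ### Block systems and the doubling argument -/

/-- A system of `k` sets split into consecutive blocks (`l i` is the first index of the block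
of `i`). Inside a block the relation `R` is hereditarily dense down to size `τ`; from a block to a
later one each vertex has few `B`-neighbours. -/
structure BlockSystem {V : Type*} (R B : V → V → Prop) (ρ β κ L : ℝ) (k : ℕ)
    (A : ℕ → Finset V) (l w : ℕ → ℕ) (τ : ℕ → ℝ) : Prop where
  mono : ∀ i j, i ≤ j → j < k → l i ≤ l j
  le_self : ∀ i, i < k → l i ≤ i
  lt_add : ∀ i, i < k → i < l i + w i
  le_tau : ∀ i, i < k → L ≤ τ i
  size : ∀ i, i < k → τ i * κ * ρ⁻¹ ^ w i ≤ #(A i)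
  dense : ∀ i j, i < j → j < k → l i = l j → ∀ Y ⊆ A j, τ j ≤ #Y →
    (#{x ∈ A i | (#{y ∈ Y | R x y} : ℝ) < ρ * #Y} : ℝ) < τ i
  sparse : ∀ i j, i < k → j < k → l i < l j → ∀ x ∈ A i,
    (#{y ∈ A j | B x y} : ℝ) ≤ β * #(A j)

/-- The set `U` contains a block system of length `k`. -/
def HasBlockSystem {V : Type*} (R B : V → V → Prop) (ρ β κ L : ℝ) (k : ℕ) (U : Finset V) : Prop :=
  ∃ A l w τ, BlockSystem R B ρ β κ L k A l w τ ∧ ∀ i < k, A i ⊆ U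

section
variable {V : Type*} {R B : V → V → Prop} {ρ β κ L : ℝ}

lemma HasBlockSystem.mono {k : ℕ} {U U' : Finset V} (h : HasBlockSystem R B ρ β κ L k U)
    (hU : U ⊆ U') : HasBlockSystem R B ρ β κ L k U' := by
  obtain ⟨A, l, w, τ, h, hA⟩ := h
  exact ⟨A, l, w, τ, h, fun i hi => (hA i hi).trans hU⟩

/-- A set in which `R` is hereditarily dense is a system with a single block. -/
lemma hasBlockSystem_of_dense {k : ℕ} {U : Finset V} {τ : ℝ} (hL : L ≤ τ)
    (hU : τ * κ * ρ⁻¹ ^ k ≤ #U)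
    (hd : 1 < k → ∀ Y ⊆ U, τ ≤ #Y → (#{x ∈ U | (#{y ∈ Y | R x y} : ℝ) < ρ * #Y} : ℝ) < τ) :
    HasBlockSystem R B ρ β κ L k U := by
  refine ⟨fun _ => U, fun _ => 0, fun _ => k, fun _ => τ, ⟨?_, ?_, ?_, ?_, ?_, ?_, ?_⟩, ?_⟩
  · simp
  · simp
  · simp
  · simp [hL]
  · intro i _
    exact hU
  · intro i j hij hj _ Y hY hτ
    exact hd (by omega) Y hY hτ
  · simp
  · simp

/-- Concatenation of two block systems. -/
lemma hasBlockSystem_append {k : ℕ} {U : Finset V} {A A' : ℕ → Finset V} {l l' w w' : ℕ → ℕ}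
    {τ τ' : ℕ → ℝ} (h : BlockSystem R B ρ β κ L k A l w τ)
    (h' : BlockSystem R B ρ β κ L k A' l' w' τ')
    (hA : ∀ i < k, A i ⊆ U) (hA' : ∀ i < k, A' i ⊆ U)
    (hs : ∀ i < k, ∀ j < k, ∀ x ∈ A i, (#{y ∈ A' j | B x y} : ℝ) ≤ β * #(A' j)) :
    HasBlockSystem R B ρ β κ L (2 * k) U := by
  refine ⟨fun i => if i < k then A i else A' (i - k),
    fun i => if i < k then l i else l' (i - k) + k,
    fun i => if i < k then w i else w' (i - k),
    fun i => if i < k then τ i else τ' (i - k), ⟨?_, ?_, ?_, ?_, ?_, ?_, ?_⟩, ?_⟩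
  · intro i j hij hj
    by_cases hik : i < k <;> by_cases hjk : j < k <;> simp only [hik, hjk, if_true, if_false]
    · exact h.mono i j hij hjk
    · have := h.le_self i hik
      omega
    · omega
    · have := h'.mono (i - k) (j - k) (by omega) (by omega)
      omega
  · intro i hi
    by_cases hik : i < k <;> simp only [hik, if_true, if_false]
    · exact h.le_self i hik
    · have := h'.le_self (i - k) (by omega)
      omega
  · intro i hi
    by_cases hik : i < k <;> simp only [hik, if_true, if_false]
    · exact h.lt_add i hik
    · have := h'.lt_add (i - k) (by omega)
      omega
  · intro i hi
    by_cases hik : i < k <;> simp only [hik, if_true, if_false]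
    · exact h.le_tau i hik
    · exact h'.le_tau (i - k) (by omega)
  · intro i hi
    by_cases hik : i < k <;> simp only [hik, if_true, if_false]
    · exact h.size i hik
    · exact h'.size (i - k) (by omega)
  · intro i j hij hj
    by_cases hik : i < k <;> by_cases hjk : j < k <;> simp only [hik, hjk, if_true, if_false]
    · exact h.dense i j hij hjk
    · intro he
      have := h.le_self i hik
      omega
    · omega
    · intro he
      exact h'.dense (i - k) (j - k) (by omega) (by omega) (by omega)
  · intro i j hi hj
    by_cases hik : i < k <;> by_cases hjk : j < k <;> simp only [hik, hjk, if_true, if_false]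
    · exact h.sparse i j hik hjk
    · intro _
      exact hs i hik (j - k) (by omega)
    · intro hl
      have := h.le_self j hjk
      omega
    · intro hl
      exact h'.sparse (i - k) (j - k) (by omega) (by omega) (by omega)
  · intro i hi
    by_cases hik : i < k <;> simp only [hik, if_true, if_false]
    · exact hA i hik
    · exact hA' (i - k) (by omega)

/-- Double counting of the `R`-pairs between `S` and `Y`, followed by Markov's inequality. -/
lemma card_filter_degree_gt_le (hR : ∀ x y, R x y → R y x) {S Y : Finset V} (hS : S.Nonempty)
    (h : ∀ x ∈ S, (#{y ∈ Y | R x y} : ℝ) ≤ ρ * #Y) :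
    β * (#{y ∈ Y | β * #S < (#{x ∈ S | R y x} : ℝ)} : ℝ) ≤ ρ * #Y := by
  have hS' : (0 : ℝ) < #S := by exact_mod_cast hS.card_pos
  have e : ∑ y ∈ Y, (#{x ∈ S | R y x} : ℝ) = ∑ x ∈ S, (#{y ∈ Y | R x y} : ℝ) := by
    have := Finset.sum_card_bipartiteAbove_eq_sum_card_bipartiteBelow (s := S) (t := Y) R
    have h2 : ∀ y, #{x ∈ S | R y x} = #(Finset.bipartiteBelow R S y) := by
      intro y
      congr 1
      ext x
      simp only [Finset.mem_filter, Finset.mem_bipartiteBelow]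
      exact ⟨fun hh => ⟨hh.1, hR _ _ hh.2⟩, fun hh => ⟨hh.1, hR _ _ hh.2⟩⟩
    simp only [h2]
    exact_mod_cast this.symm
  have h3 : (#{y ∈ Y | β * #S < (#{x ∈ S | R y x} : ℝ)} : ℝ) * (β * #S)
      ≤ ∑ y ∈ Y, (#{x ∈ S | R y x} : ℝ) := by
    rw [← nsmul_eq_mul]
    refine (Finset.card_nsmul_le_sum _ (fun y => (#{x ∈ S | R y x} : ℝ)) _ ?_).trans
      (Finset.sum_le_sum_of_subset_of_nonneg (Finset.filter_subset _ _) fun _ _ _ => by positivity)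
    intro y hy
    exact (Finset.mem_filter.1 hy).2.le
  have h4 : ∑ x ∈ S, (#{y ∈ Y | R x y} : ℝ) ≤ #S * (ρ * #Y) := by
    rw [← nsmul_eq_mul]
    exact Finset.sum_le_card_nsmul _ _ _ h
  rw [e] at h3
  refine le_of_mul_le_mul_left ?_ hS'
  linarith

/-- If large sets contain `R`-systems of length `k₁` or `B`-systems of length `k`, then much larger
sets contain `R`-systems of length `k₁` or `B`-systems of length `2 * k`. -/
lemma hasBlockSystem_or_double (hR : ∀ x y, R x y → R y x) (hρ : 0 < ρ) (hβ : 0 < β) (hκ : 0 < κ)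
    (hL : 0 < L) {m τ m' : ℝ} {k₁ k : ℕ} (hk : ρ * k ≤ β / 2) (hm : 2 * m ≤ τ)
    (hLτ : L ≤ τ) (hm' : τ * κ * ρ⁻¹ ^ k₁ ≤ m')
    (h : ∀ U : Finset V, m ≤ #U →
      HasBlockSystem R B ρ β κ L k₁ U ∨ HasBlockSystem B R ρ β κ L k U)
    (U : Finset V) (hU : m' ≤ #U) :
    HasBlockSystem R B ρ β κ L k₁ U ∨ HasBlockSystem B R ρ β κ L (2 * k) U := by
  by_cases hd : ∀ Y ⊆ U, τ ≤ #Y → (#{x ∈ U | (#{y ∈ Y | R x y} : ℝ) < ρ * #Y} : ℝ) < τ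
  · exact Or.inl (hasBlockSystem_of_dense hLτ (hm'.trans hU) fun _ => hd)
  push Not at hd
  obtain ⟨Y, hYU, hY, hX⟩ := hd
  set X := {x ∈ U | (#{y ∈ Y | R x y} : ℝ) < ρ * #Y} with hXdef
  have hXU : X ⊆ U := Finset.filter_subset _ _
  rcases h X (by linarith) with hx | ⟨A', l', w', τ', hs', hA'⟩
  · exact Or.inl (hx.mono hXU)
  set F : ℕ → Finset V := fun i => {y ∈ Y | β * #(A' i) < (#{x ∈ A' i | R y x} : ℝ)} with hF
  have hne : ∀ i < k, (A' i).Nonempty := by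
    intro i hi
    have h1 := hs'.size i hi
    have h2 := hs'.le_tau i hi
    have h3 : 0 < τ' i * κ * ρ⁻¹ ^ w' i := by
      have : 0 < τ' i := by linarith
      positivity
    rw [← Finset.card_pos]
    exact_mod_cast h3.trans_le h1
  have hFc : ∀ i < k, β * (#(F i) : ℝ) ≤ ρ * #Y := by
    intro i hi
    refine card_filter_degree_gt_le hR (hne i hi) fun x hx => ?_
    have := hA' i hi hx
    rw [hXdef, Finset.mem_filter] at this
    exact this.2.le
  -- Each `F i` has at most `(ρ / β) * #Y` elements, so by `hk` at least half of `Y`, hence at least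
  -- `τ / 2 ≥ m` vertices, survives.
  set Y' := Y \ (Finset.range k).biUnion F with hY'
  have hbig : m ≤ #Y' := by
    have h1 : (#((Finset.range k).biUnion F) : ℝ) ≤ ∑ i ∈ Finset.range k, (#(F i) : ℝ) := by
      exact_mod_cast Finset.card_biUnion_le
    have h2 : β * ∑ i ∈ Finset.range k, (#(F i) : ℝ) ≤ k * (ρ * #Y) := by
      rw [Finset.mul_sum]
      refine (Finset.sum_le_sum fun i hi => hFc i (Finset.mem_range.1 hi)).trans ?_
      simp
    have h3 : (#Y : ℝ) ≤ #Y' + #((Finset.range k).biUnion F) := by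
      have := Finset.le_card_sdiff ((Finset.range k).biUnion F) Y
      rw [← hY'] at this
      have h4 : #Y ≤ #Y' + #((Finset.range k).biUnion F) := by omega
      exact_mod_cast h4
    have h5 : β * (#((Finset.range k).biUnion F) : ℝ) ≤ β * (#Y / 2) := by
      have := mul_le_mul_of_nonneg_right hk (Nat.cast_nonneg (α := ℝ) #Y)
      have := mul_le_mul_of_nonneg_left h1 hβ.le
      linarith
    have h6 := le_of_mul_le_mul_left h5 hβ
    linarith
  have hY'U : Y' ⊆ U := Finset.sdiff_subset.trans hYU
  rcases h Y' hbig with hy | ⟨A, l, w, τ₁, hs, hA⟩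
  · exact Or.inl (hy.mono hY'U)
  -- The system in `Y'` comes first: sparsity is required only from earlier to later blocks, and it
  -- is the degrees from `Y'` into the sets `A' j` that were controlled.
  refine Or.inr (hasBlockSystem_append hs hs' (fun i hi => (hA i hi).trans hY'U)
    (fun i hi => (hA' i hi).trans hXU) fun i hi j hj x hx => ?_)
  have hx' := hA i hi hx
  rw [hY', Finset.mem_sdiff, Finset.mem_biUnion] at hx'
  by_contra hcon
  push Not at hcon
  exact hx'.2 ⟨j, Finset.mem_range.2 hj, Finset.mem_filter.2 ⟨hx'.1, hcon⟩⟩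

/-- Every large set contains a block system of length `2 ^ a` for one of the two relations. -/
lemma hasBlockSystem_or (hR : ∀ x y, R x y → R y x) (hB : ∀ x y, B x y → B y x)
    (hρ : 0 < ρ) (hρ1 : ρ ≤ 1) (hβ : 0 < β) (hκ : 1 ≤ κ) (hL : 0 < L) (a : ℕ)
    (ha : ρ * 2 ^ a ≤ β) (U : Finset V)
    (hU : L * κ * (4 * κ ^ 2) ^ a * ρ⁻¹ ^ (3 * 2 ^ a) ≤ #U) :
    HasBlockSystem R B ρ β κ L (2 ^ a) U ∨ HasBlockSystem B R ρ β κ L (2 ^ a) U := by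
  have hQ : 1 ≤ ρ⁻¹ := (one_le_inv₀ hρ).2 hρ1
  have hκ0 : 0 < κ := by linarith
  induction a generalizing U with
  | zero =>
    refine Or.inl (hasBlockSystem_of_dense le_rfl ?_ (by simp))
    refine le_trans ?_ hU
    simp only [pow_zero, mul_one, pow_one]
    have : ρ⁻¹ ≤ ρ⁻¹ ^ 3 := le_self_pow₀ hQ (by norm_num)
    gcongr
  | succ a ih =>
    have hk : ρ * ((2 ^ a : ℕ) : ℝ) ≤ β / 2 := by
      push_cast
      rw [pow_succ] at ha
      linarith
    set m := L * κ * (4 * κ ^ 2) ^ a * ρ⁻¹ ^ (3 * 2 ^ a) with hm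
    have hm0 : 0 < m := by positivity
    have hLm : L ≤ m := by
      have h1 : (1 : ℝ) ≤ κ * (4 * κ ^ 2) ^ a * ρ⁻¹ ^ (3 * 2 ^ a) := by
        refine one_le_mul_of_one_le_of_one_le (one_le_mul_of_one_le_of_one_le hκ
          (one_le_pow₀ ?_)) (one_le_pow₀ hQ)
        nlinarith
      calc L = L * 1 := (mul_one L).symm
        _ ≤ L * (κ * (4 * κ ^ 2) ^ a * ρ⁻¹ ^ (3 * 2 ^ a)) := by gcongr
        _ = m := by rw [hm]; ring
    have ih' := ih (by rw [pow_succ] at ha; nlinarith [pow_pos (two_pos (α := ℝ)) a])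
    have hQp : ∀ i, (1 : ℝ) ≤ ρ⁻¹ ^ i := fun i => one_le_pow₀ hQ
    -- One colour is doubled against length `2 ^ a`, then the other against `2 * 2 ^ a`. The
    -- threshold grows by `4 * κ ^ 2 * ρ⁻¹ ^ (3 * 2 ^ a)` in total, exactly the passage from `a` to
    -- `a + 1`.
    set m' := 2 * m * κ * ρ⁻¹ ^ 2 ^ a with hm'
    have hmm' : m ≤ m' := by
      have h1 : (1 : ℝ) ≤ κ * ρ⁻¹ ^ 2 ^ a := one_le_mul_of_one_le_of_one_le hκ (hQp _)
      rw [hm']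
      nlinarith
    have s1 := hasBlockSystem_or_double (R := B) (B := R) (m := m) (τ := 2 * m) (m' := m')
      (k₁ := 2 ^ a) (k := 2 ^ a) hB hρ hβ hκ0 hL hk le_rfl (by linarith) (by rw [hm'])
      (fun U hU => (ih' U hU).symm)
    have s2 := hasBlockSystem_or_double (R := R) (B := B) (m := m') (τ := 2 * m')
      (m' := 2 * m' * κ * ρ⁻¹ ^ (2 * 2 ^ a))
      (k₁ := 2 * 2 ^ a) (k := 2 ^ a) hR hρ hβ hκ0 hL hk le_rfl (by linarith) le_rfl
      (fun U hU => (s1 U hU).symm) U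
    rw [pow_succ' 2 a]
    refine s2 (le_trans (le_of_eq ?_) hU)
    rw [hm', hm, pow_succ' 2 a]
    ring
end

/-! ### Greedy embedding: typical vertices -/

/-- `x` relates to `a` in the way prescribed by the pair `i j` of the pattern `H`. -/
def Follows {V : Type*} (H : ℕ → ℕ → Prop) (R P : V → V → Prop) (i j : ℕ) (a x : V) : Prop :=
  a ≠ x ∧ (H i j → R a x) ∧ (¬ H i j → ¬ P a x)

/-- The candidate sets `C j` for the images of the indices `j ≥ t` left after `t` steps of the
greedy embedding. -/
structure Candidates {V : Type*} (B : V → V → Prop) (ρ : ℝ) (n : ℕ) (A : ℕ → Finset V)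
    (l : ℕ → ℕ) (t : ℕ) (C : ℕ → Finset V) : Prop where
  sub : ∀ j, t ≤ j → j < n → C j ⊆ A j
  size : ∀ j, t ≤ j → j < n → (1 / 4 : ℝ) ^ t * ρ ^ (t - l j) * #(A j) ≤ #(C j)
  sparse : ∀ j k, t ≤ j → j < n → k < n → l j < l k → ∀ x ∈ C j,
    (#{y ∈ C k | B x y} : ℝ) ≤ ρ * (n + t) * #(C k)

/-- The vertices `x` of `X` whose `B`-neighbourhood in `Y` is split unevenly by `v`. -/
noncomputable def unevenSet {V : Type*} (P B : V → V → Prop) (ε : ℝ) (X Y : Finset V) (v : V) :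
    Finset V :=
  {x ∈ X | ε * #Y ≤ |(#{y ∈ {y ∈ Y | B x y} | P v y} : ℝ) - #{y ∈ Y | B x y} / 2|}

section
variable {V : Type*} {P R B : V → V → Prop} {ρ δ β κ L : ℝ}
  {n t : ℕ} {A C : ℕ → Finset V} {l w : ℕ → ℕ} {τ : ℕ → ℝ}

/-- Since `t ≤ j < l j + w j`, at most `w j` factors `ρ` have been lost. The `4 ^ n` in `κ` pays for
the factors `1 / 4`, and the remaining `4 * n` leaves room to avoid all bad vertices. -/
lemma Candidates.le_card (hC : Candidates B ρ n A l t C)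
    (hA : BlockSystem R B ρ β (4 ^ n * (4 * n)) L n A l w τ) (hρ : 0 < ρ) (hρ1 : ρ ≤ 1)
    (hL : 0 < L) {j : ℕ} (htj : t ≤ j) (hj : j < n) : 4 * n * τ j ≤ #(C j) := by
  have hτ := hA.le_tau j hj
  have h1 : ρ ^ w j ≤ ρ ^ (t - l j) :=
    pow_le_pow_of_le_one hρ.le hρ1 (by have := hA.lt_add j hj; omega)
  have h2 : (1 / 4 : ℝ) ^ n ≤ (1 / 4) ^ t :=
    pow_le_pow_of_le_one (by norm_num) (by norm_num) (by omega)
  calc 4 * n * τ j = (1 / 4) ^ n * ρ ^ w j * (τ j * (4 ^ n * (4 * n)) * ρ⁻¹ ^ w j) := by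
        rw [inv_pow, one_div, inv_pow]
        field_simp
    _ ≤ (1 / 4) ^ t * ρ ^ (t - l j) * #(A j) := by
        have := hA.size j hj
        have : 0 < τ j := by linarith
        gcongr
    _ ≤ #(C j) := hC.size j htj hj

variable [Fintype V]

lemma HasSecondMoment.card_mul_le (hP : HasSecondMoment P) {Y Z : Finset V} (hZ : Z ⊆ Y)
    (hδ : 0 < δ) (hL : 0 < L) (hY : L ≤ #Y) :
    (#{v : V | δ * #Y ≤ |(#{y ∈ Z | P v y} : ℝ) - #Z / 2|} : ℝ) * (δ ^ 2 * L) ≤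
      Fintype.card V := by
  have hY0 : (0 : ℝ) < #Y := by linarith
  have h := hP Z (δ * #Y) (by positivity)
  have hc : (#Z : ℝ) ≤ #Y := by exact_mod_cast Finset.card_le_card hZ
  set b : ℝ := (#{v : V | δ * #Y ≤ |(#{y ∈ Z | P v y} : ℝ) - #Z / 2|} : ℝ)
  have hb : 0 ≤ b := Nat.cast_nonneg _
  have h1 : b * (δ ^ 2 * #Y) ≤ Fintype.card V := by
    refine le_of_mul_le_mul_right ?_ hY0
    calc b * (δ ^ 2 * #Y) * (#Y : ℝ) = b * (δ * #Y) ^ 2 := by ring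
      _ ≤ (Fintype.card V : ℝ) * #Z := h
      _ ≤ (Fintype.card V : ℝ) * #Y := by gcongr
  refine le_trans ?_ h1
  gcongr

/-- For each `x` the second moment bounds the number of `v` splitting its `B`-neighbourhood
unevenly; exchanging the sums and applying Markov's inequality bounds the `v` that do so for many
`x`. -/
lemma HasSecondMoment.card_unevenSet_mul_le (hP : HasSecondMoment P) {X Y : Finset V} {ε E : ℝ}
    (hε : 0 < ε) (hL : 0 < L) (hY : L ≤ #Y) :
    (#{v : V | E < #(unevenSet P B ε X Y v)} : ℝ) * (E * (ε ^ 2 * L)) ≤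
      (Fintype.card V : ℝ) ^ 2 := by
  have h1 : (#{v : V | E < #(unevenSet P B ε X Y v)} : ℝ) * E ≤
      ∑ v : V, (#(unevenSet P B ε X Y v) : ℝ) := by
    rw [← nsmul_eq_mul]
    refine (Finset.card_nsmul_le_sum _ (fun v => (#(unevenSet P B ε X Y v) : ℝ)) _ ?_).trans
      (Finset.sum_le_sum_of_subset_of_nonneg (Finset.subset_univ _) fun _ _ _ => by positivity)
    intro v hv
    exact (Finset.mem_filter.1 hv).2.le
  have h2 : ∑ v : V, (#(unevenSet P B ε X Y v) : ℝ) = ∑ x ∈ X,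
      (#{v : V | ε * #Y ≤ |(#{y ∈ {y ∈ Y | B x y} | P v y} : ℝ) - #{y ∈ Y | B x y} / 2|} : ℝ) := by
    have := Finset.sum_card_bipartiteAbove_eq_sum_card_bipartiteBelow (s := (Finset.univ : Finset V))
      (t := X) fun v x =>
        ε * #Y ≤ |(#{y ∈ {y ∈ Y | B x y} | P v y} : ℝ) - #{y ∈ Y | B x y} / 2|
    exact_mod_cast this
  calc (#{v : V | E < #(unevenSet P B ε X Y v)} : ℝ) * (E * (ε ^ 2 * L))
      = ((#{v : V | E < #(unevenSet P B ε X Y v)} : ℝ) * E) * (ε ^ 2 * L) := by ring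
    _ ≤ (∑ v : V, (#(unevenSet P B ε X Y v) : ℝ)) * (ε ^ 2 * L) := by gcongr
    _ = ∑ x ∈ X, (#{v : V | ε * #Y ≤
          |(#{y ∈ {y ∈ Y | B x y} | P v y} : ℝ) - #{y ∈ Y | B x y} / 2|} : ℝ) * (ε ^ 2 * L) := by
        rw [h2, Finset.sum_mul]
    _ ≤ #X • (Fintype.card V : ℝ) := Finset.sum_le_card_nsmul _ _ _ fun x _ =>
        hP.card_mul_le (Finset.filter_subset _ _) hε hL hY
    _ ≤ (Fintype.card V : ℝ) ^ 2 := by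
        rw [nsmul_eq_mul, sq]
        gcongr
        exact_mod_cast Finset.card_le_univ X

/-- Some candidate for `t` behaves typically with respect to all later candidate sets. -/
lemma Candidates.exists_typical (hC : Candidates B ρ n A l t C)
    (hA : BlockSystem R B ρ β (4 ^ n * (4 * n)) L n A l w τ) (hP : HasSecondMoment P)
    (hρ : 0 < ρ) (hρ1 : ρ ≤ 1) (hδ : 0 < δ) (hL : 0 < L) (ht : t < n)
    (hN1 : (Fintype.card V : ℝ) ≤ δ ^ 2 * L ^ 2)
    (hN2 : 4 * n ^ 2 * (Fintype.card V : ℝ) ^ 2 ≤ (ρ * δ) ^ 2 * ρ * L ^ 3) :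
    ∃ v ∈ C t, ∀ k, t < k → k < n →
      |(#{y ∈ C k | P v y} : ℝ) - #(C k) / 2| < δ * #(C k) ∧
      (l t = l k → ρ * #(C k) ≤ #{y ∈ C k | R v y}) ∧
      ∀ j, t < j → j < n → (#(unevenSet P B (ρ * δ) (C j) (C k) v) : ℝ) ≤ ρ * L / (4 * n) := by
  have hn1 : (1 : ℝ) ≤ n := by exact_mod_cast (by omega : 1 ≤ n)
  have hn0 : (0 : ℝ) < n := by linarith
  have hcard : ∀ k, t ≤ k → k < n → L ≤ #(C k) ∧ τ k ≤ #(C k) := by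
    intro k htk hk
    have h1 := hC.le_card hA hρ hρ1 hL htk hk
    have h2 := hA.le_tau k hk
    constructor <;> nlinarith
  set F₁ : ℕ → Finset V := fun k => {v | δ * #(C k) ≤ |(#{y ∈ C k | P v y} : ℝ) - #(C k) / 2|}
  set F₂ : ℕ → Finset V := fun k => if l t = l k then
    {v ∈ C t | (#{y ∈ C k | R v y} : ℝ) < ρ * #(C k)} else ∅ with hF₂
  set F₃ : ℕ × ℕ → Finset V := fun p =>
    {v | ρ * L / (4 * n) < #(unevenSet P B (ρ * δ) (C p.1) (C p.2) v)}
  set I := Finset.Ioo t n with hI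
  have hIn : (#I : ℝ) ≤ n := by
    rw [hI, Nat.card_Ioo]
    exact_mod_cast (by omega : n - t - 1 ≤ n)
  have b1 : ∀ k ∈ I, (#(F₁ k) : ℝ) ≤ L := by
    intro k hk
    rw [hI, Finset.mem_Ioo] at hk
    have h1 := hP.card_mul_le (Finset.Subset.refl (C k)) hδ hL (hcard k hk.1.le hk.2).1
    refine le_of_mul_le_mul_right (h1.trans (hN1.trans (le_of_eq ?_)))
      (by positivity : 0 < δ ^ 2 * L)
    ring
  have b2 : ∀ k ∈ I, (#(F₂ k) : ℝ) ≤ τ t := by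
    intro k hk
    rw [hI, Finset.mem_Ioo] at hk
    simp only [hF₂]
    split_ifs with hl
    · refine le_trans ?_ (hA.dense t k hk.1 hk.2 hl (C k) (hC.sub k hk.1.le hk.2)
        (hcard k hk.1.le hk.2).2).le
      exact_mod_cast Finset.card_le_card (Finset.filter_subset_filter _ (hC.sub t le_rfl ht))
    · have := hA.le_tau t ht
      simp only [Finset.card_empty, Nat.cast_zero]
      linarith
  have b3 : ∀ p ∈ I ×ˢ I, (#(F₃ p) : ℝ) ≤ L / n := by
    intro p hp
    rw [Finset.mem_product, hI, Finset.mem_Ioo, Finset.mem_Ioo] at hp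
    have h1 := hP.card_unevenSet_mul_le (B := B) (X := C p.1) (E := ρ * L / (4 * n))
      (by positivity : 0 < ρ * δ) hL (hcard p.2 hp.2.1.le hp.2.2).1
    refine le_of_mul_le_mul_right (h1.trans ?_)
      (by positivity : 0 < ρ * L / (4 * n) * ((ρ * δ) ^ 2 * L))
    have e : L / n * (ρ * L / (4 * n) * ((ρ * δ) ^ 2 * L))
        = ((ρ * δ) ^ 2 * ρ * L ^ 3) / (4 * n ^ 2) := by
      field_simp
    rw [e, le_div_iff₀ (by positivity)]
    linarith
  set U := I.biUnion F₁ ∪ I.biUnion F₂ ∪ (I ×ˢ I).biUnion F₃ with hU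
  -- The three kinds of bad vertices number at most `n * L`, `n * τ t` and `n * L`, together less
  -- than `4 * n * τ t`.
  have hUc : (#U : ℝ) < #(C t) := by
    have c1 : (#(I.biUnion F₁) : ℝ) ≤ n * L := by
      refine (by exact_mod_cast Finset.card_biUnion_le :
        (#(I.biUnion F₁) : ℝ) ≤ ∑ k ∈ I, (#(F₁ k) : ℝ)).trans ?_
      refine (Finset.sum_le_card_nsmul _ _ _ b1).trans ?_
      rw [nsmul_eq_mul]
      gcongr
    have hτ := hA.le_tau t ht
    have c2 : (#(I.biUnion F₂) : ℝ) ≤ n * τ t := by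
      refine (by exact_mod_cast Finset.card_biUnion_le :
        (#(I.biUnion F₂) : ℝ) ≤ ∑ k ∈ I, (#(F₂ k) : ℝ)).trans ?_
      refine (Finset.sum_le_card_nsmul _ _ _ b2).trans ?_
      rw [nsmul_eq_mul]
      have : 0 ≤ τ t := by linarith
      gcongr
    have c3 : (#((I ×ˢ I).biUnion F₃) : ℝ) ≤ n * L := by
      refine (by exact_mod_cast Finset.card_biUnion_le :
        (#((I ×ˢ I).biUnion F₃) : ℝ) ≤ ∑ p ∈ I ×ˢ I, (#(F₃ p) : ℝ)).trans ?_
      refine (Finset.sum_le_card_nsmul _ _ _ b3).trans ?_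
      rw [nsmul_eq_mul, Finset.card_product]
      push_cast
      calc (#I : ℝ) * #I * (L / n) ≤ n * n * (L / n) := by gcongr
        _ = n * L := by field_simp
    have c4 : (#U : ℝ) ≤ #(I.biUnion F₁) + #(I.biUnion F₂) + #((I ×ˢ I).biUnion F₃) := by
      exact_mod_cast (Finset.card_union_le _ _).trans
        (Nat.add_le_add_right (Finset.card_union_le _ _) _)
    have h1 := hC.le_card hA hρ hρ1 hL le_rfl ht
    nlinarith
  obtain ⟨v, hv, hvU⟩ : ∃ v ∈ C t, v ∉ U := by
    by_contra hcon
    push Not at hcon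
    have : (#(C t) : ℝ) ≤ #U := by exact_mod_cast Finset.card_le_card hcon
    linarith
  simp only [hU, Finset.mem_union, Finset.mem_biUnion, not_or, not_exists, not_and] at hvU
  refine ⟨v, hv, fun k htk hk => ⟨?_, fun hl => ?_, fun j htj hj => ?_⟩⟩
  · by_contra hcon
    exact hvU.1.1 k (Finset.mem_Ioo.2 ⟨htk, hk⟩)
      (Finset.mem_filter.2 ⟨Finset.mem_univ _, not_lt.1 hcon⟩)
  · by_contra hcon
    refine hvU.1.2 k (Finset.mem_Ioo.2 ⟨htk, hk⟩) ?_
    simp only [hF₂, hl, if_true]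
    exact Finset.mem_filter.2 ⟨hv, not_le.1 hcon⟩
  · by_contra hcon
    exact hvU.2 (j, k) (Finset.mem_product.2 ⟨Finset.mem_Ioo.2 ⟨htj, hj⟩, Finset.mem_Ioo.2 ⟨htk, hk⟩⟩)
      (Finset.mem_filter.2 ⟨Finset.mem_univ _, not_le.1 hcon⟩)
end

/-! ### Greedy embedding: one step and iteration -/

section
variable {V : Type*} {P R B : V → V → Prop} {H : ℕ → ℕ → Prop} {ρ δ β κ L : ℝ}
  {n t : ℕ} {A C : ℕ → Finset V} {l w : ℕ → ℕ} {τ : ℕ → ℝ}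

/-- The candidates for `j` that remain after `v` has been chosen for `t`. -/
noncomputable def restrictCandidates (P R B : V → V → Prop) (H : ℕ → ℕ → Prop) (ε : ℝ) (n t : ℕ)
    (l : ℕ → ℕ) (C : ℕ → Finset V) (v : V) (j : ℕ) : Finset V :=
  {x ∈ C j | Follows H R P t j v x ∧
    ∀ k, t < k → k < n → l j < l k → x ∉ unevenSet P B ε (C j) (C k) v}

lemma restrictCandidates_subset (ε : ℝ) (v : V) (j : ℕ) :
    restrictCandidates P R B H ε n t l C v j ⊆ C j :=
  Finset.filter_subset _ _

/-- The lower bound for the number of remaining candidates in terms of the number of candidates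
`S` that have the prescribed relation to `v`, up to an exceptional set `D`. -/
lemma le_card_restrictCandidates {ε E : ℝ} {v : V} {j : ℕ} (S D : Finset V) (hE : 0 ≤ E)
    (hS : ∀ x ∈ S, x ∉ D → v ≠ x → x ∈ C j ∧ Follows H R P t j v x)
    (hu : ∀ k, t < k → k < n → (#(unevenSet P B ε (C j) (C k) v) : ℝ) ≤ E) :
    (#S : ℝ) - #D - 1 - n * E ≤ #(restrictCandidates P R B H ε n t l C v j) := by
  set W := (Finset.Ioo t n).biUnion fun k => unevenSet P B ε (C j) (C k) v with hW
  have hsub : S ⊆ restrictCandidates P R B H ε n t l C v j ∪ D ∪ {v} ∪ W := by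
    intro x hx
    simp only [Finset.mem_union, Finset.mem_singleton]
    by_cases h1 : x ∈ D
    · simp [h1]
    by_cases h2 : x = v
    · simp [h2]
    by_cases h3 : x ∈ W
    · simp [h3]
    obtain ⟨h4, h5⟩ := hS x hx h1 (Ne.symm h2)
    refine Or.inl (Or.inl (Or.inl (Finset.mem_filter.2 ⟨h4, h5, fun k htk hk _ hmem => h3 ?_⟩)))
    rw [hW, Finset.mem_biUnion]
    exact ⟨k, Finset.mem_Ioo.2 ⟨htk, hk⟩, hmem⟩
  have hWc : (#W : ℝ) ≤ n * E := by
    refine (by exact_mod_cast Finset.card_biUnion_le : (#W : ℝ) ≤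
      ∑ k ∈ Finset.Ioo t n, (#(unevenSet P B ε (C j) (C k) v) : ℝ)).trans ?_
    refine (Finset.sum_le_card_nsmul _ _ E fun k hk => hu k (Finset.mem_Ioo.1 hk).1
      (Finset.mem_Ioo.1 hk).2).trans ?_
    rw [nsmul_eq_mul, Nat.card_Ioo]
    gcongr
    omega
  have h1 : #S ≤ #(restrictCandidates P R B H ε n t l C v j) + #D + 1 + #W := by
    refine (Finset.card_le_card hsub).trans ((Finset.card_union_le _ _).trans ?_)
    refine Nat.add_le_add_right ((Finset.card_union_le _ _).trans ?_) _
    rw [Finset.card_singleton]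
    exact Nat.add_le_add_right (Finset.card_union_le _ _) _
  have h2 : (#S : ℝ) ≤ #(restrictCandidates P R B H ε n t l C v j) + #D + 1 + #W := by
    exact_mod_cast h1
  linarith

/-- The pair `v y` is an edge of `P` exactly if `i j` is an edge of the pattern `H`. -/
def Agrees (H : ℕ → ℕ → Prop) (P : V → V → Prop) (i j : ℕ) (v y : V) : Prop := H i j ↔ P v y

/-- Complementation only changes the sign of the deviation from one half, so edges and non-edges of
the pattern can be treated alike. -/
lemma abs_card_filter_agrees (Z : Finset V) (v : V) (i j : ℕ) :
    |(#{y ∈ Z | Agrees H P i j v y} : ℝ) - #Z / 2| = |(#{y ∈ Z | P v y} : ℝ) - #Z / 2| := by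
  by_cases hH : H i j
  · have h1 : {y ∈ Z | Agrees H P i j v y} = {y ∈ Z | P v y} :=
      Finset.filter_congr fun y _ => by simp [Agrees, hH]
    rw [h1]
  · have h1 : {y ∈ Z | Agrees H P i j v y} = {y ∈ Z | ¬ P v y} :=
      Finset.filter_congr fun y _ => by simp [Agrees, hH]
    have h2 : (#{y ∈ Z | P v y} : ℝ) + #{y ∈ Z | ¬ P v y} = #Z := by
      exact_mod_cast Finset.card_filter_add_card_filter_not (s := Z) (P v)
    rw [h1, ← abs_neg]
    congr 1
    linarith

variable [Fintype V]

/-- Some candidate for `t` leaves many candidates for all later indices. -/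
lemma Candidates.exists_sizes (hC : Candidates B ρ n A l t C)
    (hA : BlockSystem R B ρ (ρ * n) (4 ^ n * (4 * n)) L n A l w τ) (hP : HasSecondMoment P)
    (hPR : ∀ x y, x ≠ y → P x y → R x y ∨ B x y)
    (hρ : 0 < ρ) (hδ : 0 < δ) (hρδ : 2 * n * ρ ≤ δ) (hδn : 16 * n * δ ≤ 1) (ht : t < n)
    (hL : 4 ≤ ρ * L) (hL0 : 0 < L)
    (hN1 : (Fintype.card V : ℝ) ≤ δ ^ 2 * L ^ 2)
    (hN2 : 4 * n ^ 2 * (Fintype.card V : ℝ) ^ 2 ≤ (ρ * δ) ^ 2 * ρ * L ^ 3) :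
    ∃ v ∈ C t,
      (∀ j, t < j → j < n → l t = l j →
        ρ / 2 * #(C j) ≤ #(restrictCandidates P R B H (ρ * δ) n t l C v j)) ∧
      ∀ j, t < j → j < n → l t < l j →
        (1 / 2 - 2 * δ - ρ * (n + t)) * #(C j) ≤
          #(restrictCandidates P R B H (ρ * δ) n t l C v j) := by
  have hn1 : (1 : ℝ) ≤ n := by exact_mod_cast (by omega : 1 ≤ n)
  have hn0 : (0 : ℝ) < n := by linarith
  have htn : (t : ℝ) + 1 ≤ n := by exact_mod_cast ht
  have hδ1 : 16 * δ ≤ 1 := by nlinarith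
  have hρ1 : 2 * ρ ≤ δ := by nlinarith
  have hρnt : ρ * (n + t) ≤ δ := by nlinarith
  obtain ⟨v, hv, hvk⟩ := hC.exists_typical hA hP hρ (by linarith) hδ hL0 ht hN1 hN2
  have hcard : ∀ k, t ≤ k → k < n → L ≤ #(C k) := by
    intro k htk hk
    have h1 := hC.le_card hA hρ (by linarith) hL0 htk hk
    have h2 := hA.le_tau k hk
    nlinarith
  set C' := restrictCandidates P R B H (ρ * δ) n t l C v with hC'
  -- All uneven vertices, together with `v` itself, cost at most `ρ * L / 4 + 1 ≤ ρ * L / 2`, at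
  -- most half of the fraction `ρ` of `C j`.
  have hE : (n : ℝ) * (ρ * L / (4 * n)) = ρ * L / 4 := by field_simp
  have hsplit : ∀ j, t < j → j < n →
      (1 / 2 - δ) * #(C j) ≤ (#{y ∈ C j | Agrees H P t j v y} : ℝ) := by
    intro j htj hj
    have h1 := (hvk j htj hj).1
    rw [← abs_card_filter_agrees (H := H) (i := t) (j := j)] at h1
    have := (abs_lt.1 h1).1
    linarith
  have hsame : ∀ j, t < j → j < n → l t = l j → ρ / 2 * #(C j) ≤ #(C' j) := by
    intro j htj hj hl
    have hLj := hcard j htj.le hj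
    obtain ⟨S, hS, hSc⟩ : ∃ S : Finset V, (∀ x ∈ S, v ≠ x → x ∈ C j ∧ Follows H R P t j v x) ∧
        ρ * #(C j) ≤ #S := by
      by_cases hH : H t j
      · refine ⟨{y ∈ C j | R v y}, fun x hx hvx => ?_, (hvk j htj hj).2.1 hl⟩
        rw [Finset.mem_filter] at hx
        exact ⟨hx.1, hvx, fun _ => hx.2, fun h => absurd hH h⟩
      · refine ⟨{y ∈ C j | Agrees H P t j v y}, fun x hx hvx => ?_, ?_⟩
        · rw [Finset.mem_filter] at hx
          exact ⟨hx.1, hvx, fun h => absurd h hH, fun h hp => h (hx.2.2 hp)⟩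
        · refine le_trans ?_ (hsplit j htj hj)
          gcongr
          linarith
    have h1 := le_card_restrictCandidates (l := l) (n := n) (B := B) S ∅
      (by positivity : 0 ≤ ρ * L / (4 * n)) (fun x hx _ hvx => hS x hx hvx)
      (fun k htk hk => (hvk k htk hk).2.2 j htj hj)
    rw [hE, ← hC'] at h1
    simp only [Finset.card_empty, Nat.cast_zero, sub_zero] at h1
    have h2 : ρ * L ≤ ρ * #(C j) := by gcongr
    linarith
  have hdiff : ∀ j, t < j → j < n → l t < l j →
      (1 / 2 - 2 * δ - ρ * (n + t)) * #(C j) ≤ #(C' j) := by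
    intro j htj hj hl
    have hLj := hcard j htj.le hj
    obtain ⟨S, D, hS, hSc, hD⟩ : ∃ S D : Finset V,
        (∀ x ∈ S, x ∉ D → v ≠ x → x ∈ C j ∧ Follows H R P t j v x) ∧
        (1 / 2 - δ) * #(C j) ≤ #S ∧ (#D : ℝ) ≤ ρ * (n + t) * #(C j) := by
      by_cases hH : H t j
      · refine ⟨{y ∈ C j | Agrees H P t j v y}, {y ∈ C j | B v y}, fun x hx hxD hvx => ?_,
          hsplit j htj hj, hC.sparse t j le_rfl ht hj hl v hv⟩
        rw [Finset.mem_filter] at hx hxD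
        refine ⟨hx.1, hvx, fun _ => ?_, fun h => absurd hH h⟩
        exact (hPR v x hvx (hx.2.1 hH)).resolve_right fun h => hxD ⟨hx.1, h⟩
      · refine ⟨{y ∈ C j | Agrees H P t j v y}, ∅, fun x hx _ hvx => ?_, hsplit j htj hj, ?_⟩
        · rw [Finset.mem_filter] at hx
          exact ⟨hx.1, hvx, fun h => absurd h hH, fun h hp => h (hx.2.2 hp)⟩
        · simp only [Finset.card_empty, Nat.cast_zero]
          positivity
    have h1 := le_card_restrictCandidates (l := l) (n := n) (B := B) S D
      (by positivity : 0 ≤ ρ * L / (4 * n)) hS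
      (fun k htk hk => (hvk k htk hk).2.2 j htj hj)
    rw [hE, ← hC'] at h1
    have h2 : ρ * L ≤ ρ * #(C j) := by gcongr
    have h3 : ρ * #(C j) ≤ δ * (#(C j) : ℝ) := by
      gcongr
      linarith
    linarith
  exact ⟨v, hv, hsame, hdiff⟩

/-- One step of the greedy embedding. -/
lemma Candidates.exists_next (hC : Candidates B ρ n A l t C)
    (hA : BlockSystem R B ρ (ρ * n) (4 ^ n * (4 * n)) L n A l w τ) (hP : HasSecondMoment P)
    (hPR : ∀ x y, x ≠ y → P x y → R x y ∨ B x y)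
    (hRP : ∀ x y, R x y → P x y) (hρ : 0 < ρ) (hδ : 0 < δ) (hρδ : 2 * n * ρ ≤ δ) (hδn : 16 * n * δ ≤ 1) (ht : t < n)
    (hL : 4 ≤ ρ * L) (hL0 : 0 < L)
    (hN1 : (Fintype.card V : ℝ) ≤ δ ^ 2 * L ^ 2)
    (hN2 : 4 * n ^ 2 * (Fintype.card V : ℝ) ^ 2 ≤ (ρ * δ) ^ 2 * ρ * L ^ 3) :
    ∃ v ∈ C t, ∃ C', Candidates B ρ n A l (t + 1) C' ∧
      ∀ j, t < j → j < n → ∀ x ∈ C' j, x ∈ C j ∧ Follows H R P t j v x := by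
  have hn1 : (1 : ℝ) ≤ n := by exact_mod_cast (by omega : 1 ≤ n)
  have hn0 : (0 : ℝ) < n := by linarith
  have htn : (t : ℝ) + 1 ≤ n := by exact_mod_cast ht
  have hδ1 : 16 * δ ≤ 1 := by nlinarith
  have hρ1 : 2 * ρ ≤ δ := by nlinarith
  have hρnt : ρ * (n + t) ≤ δ := by nlinarith
  obtain ⟨v, hv, hsame, hdiff⟩ := hC.exists_sizes (H := H) hA hP hPR hρ hδ hρδ hδn ht hL hL0 hN1 hN2
  set C' := restrictCandidates P R B H (ρ * δ) n t l C v with hC'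
  refine ⟨v, hv, C', ⟨fun j htj hj => ?_, fun j htj hj => ?_, fun j k htj hj hk hl x hx => ?_⟩,
    fun j htj hj x hx => ?_⟩
  · exact (restrictCandidates_subset _ _ _).trans (hC.sub j (by omega) hj)
  · have h1 := hC.size j (by omega) hj
    have hC0 : (0 : ℝ) ≤ #(C j) := Nat.cast_nonneg _
    -- In the block of `t`, `l j = l t ≤ t`, so the truncated exponent `t - l j` grows by one and
    -- pays for the lost `ρ`. For a later block the factor `1 / 4` suffices.
    rcases (hA.mono t j (by omega) hj).eq_or_lt with hl | hl
    · have h2 := hsame j (by omega) hj hl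
      have h3 : t + 1 - l j = (t - l j) + 1 := by
        have := hA.le_self t ht
        omega
      rw [h3, pow_succ, pow_succ]
      nlinarith [mul_nonneg hρ.le hC0]
    · have h2 := hdiff j (by omega) hj hl
      have h3 : ρ ^ (t + 1 - l j) ≤ ρ ^ (t - l j) :=
        pow_le_pow_of_le_one hρ.le (by linarith) (by omega)
      calc (1 / 4 : ℝ) ^ (t + 1) * ρ ^ (t + 1 - l j) * #(A j)
          ≤ (1 / 4 : ℝ) ^ (t + 1) * ρ ^ (t - l j) * #(A j) := by gcongr
        _ = 1 / 4 * ((1 / 4 : ℝ) ^ t * ρ ^ (t - l j) * #(A j)) := by ring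
        _ ≤ 1 / 4 * #(C j) := by gcongr
        _ ≤ (1 / 2 - 2 * δ - ρ * (n + t)) * #(C j) := by
            gcongr
            linarith
        _ ≤ #(C' j) := h2
  · have htk : t < k := by
      by_contra hcon
      have := hA.mono k j (by omega) hj
      omega
    have hlt : l t < l k := (hA.mono t j (by omega) hj).trans_lt hl
    have hxC : x ∈ C j := restrictCandidates_subset _ _ _ hx
    have h1 := hC.sparse j k (by omega) hj hk hl x hxC
    have h2 := hdiff k htk hk hlt
    have hnot := (Finset.mem_filter.1 hx).2.2 k htk hk hl
    have h3 : |(#{y ∈ {y ∈ C k | B x y} | P v y} : ℝ) - #{y ∈ C k | B x y} / 2|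
        < ρ * δ * #(C k) := by
      by_contra hcon
      exact hnot (Finset.mem_filter.2 ⟨hxC, not_lt.1 hcon⟩)
    have hsub : {y ∈ C' k | B x y} ⊆ {y ∈ {y ∈ C k | B x y} | Agrees H P t k v y} := by
      intro y hy
      rw [Finset.mem_filter] at hy
      obtain ⟨hyC, hyF, -⟩ := Finset.mem_filter.1 hy.1
      refine Finset.mem_filter.2 ⟨Finset.mem_filter.2 ⟨hyC, hy.2⟩,
        fun h => hRP _ _ (hyF.2.1 h), fun h => ?_⟩
      by_contra hcon
      exact hyF.2.2 hcon h
    have h4 : (#{y ∈ C' k | B x y} : ℝ) ≤ #{y ∈ C k | B x y} / 2 + ρ * δ * #(C k) := by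
      refine (by exact_mod_cast Finset.card_le_card hsub : (#{y ∈ C' k | B x y} : ℝ) ≤
        #{y ∈ {y ∈ C k | B x y} | Agrees H P t k v y}).trans ?_
      rw [← abs_card_filter_agrees (H := H) (i := t) (j := k)] at h3
      have := (abs_lt.1 h3).2
      linarith
    have hs : (n : ℝ) + t + 1 ≤ 2 * n := by linarith
    -- Passing from `n + t` to `n + t + 1` gains `1 / 2`, while the errors amount to at most `6 * n
    -- * δ + δ ≤ 7 / 16`.
    have h5 : (n + t : ℝ) / 2 + δ ≤ (n + t + 1) * (1 / 2 - 2 * δ - ρ * (n + t)) := by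
      have : (n + t + 1 : ℝ) * (2 * δ + ρ * (n + t)) ≤ 2 * n * (3 * δ) := by
        gcongr
        linarith
      nlinarith
    push_cast
    calc (#{y ∈ C' k | B x y} : ℝ) ≤ ρ * ((n + t : ℝ) / 2 + δ) * #(C k) := by linarith
      _ ≤ ρ * ((n + t + 1) * (1 / 2 - 2 * δ - ρ * (n + t))) * #(C k) := by gcongr
      _ = ρ * (n + (t + 1)) * ((1 / 2 - 2 * δ - ρ * (n + t)) * #(C k)) := by ring
      _ ≤ ρ * (n + (t + 1)) * #(C' k) := by gcongr
  · exact ⟨restrictCandidates_subset _ _ _ hx, (Finset.mem_filter.1 hx).2.1⟩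
end

/-- A block system of length `n` contains every pattern on `n` vertices. -/
lemma BlockSystem.exists_embedding {V : Type*} [Fintype V] {P R B : V → V → Prop}
    {ρ δ L : ℝ} {n : ℕ} {A : ℕ → Finset V} {l w : ℕ → ℕ} {τ : ℕ → ℝ}
    (hA : BlockSystem R B ρ (ρ * n) (4 ^ n * (4 * n)) L n A l w τ) (H : ℕ → ℕ → Prop)
    (hP : HasSecondMoment P) (hPR : ∀ x y, x ≠ y → P x y → R x y ∨ B x y)
    (hRP : ∀ x y, R x y → P x y) (hρ : 0 < ρ) (hδ : 0 < δ) (hρδ : 2 * n * ρ ≤ δ)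
    (hδn : 16 * n * δ ≤ 1) (hL : 4 ≤ ρ * L) (hL0 : 0 < L)
    (hN1 : (Fintype.card V : ℝ) ≤ δ ^ 2 * L ^ 2)
    (hN2 : 4 * n ^ 2 * (Fintype.card V : ℝ) ^ 2 ≤ (ρ * δ) ^ 2 * ρ * L ^ 3) (v₀ : V) :
    ∃ v : ℕ → V, ∀ i j, i < j → j < n → Follows H R P i j (v i) (v j) := by
  have key : ∀ m t, t + m = n → ∀ C, Candidates B ρ n A l t C → ∃ v : ℕ → V, ∀ i, t ≤ i → i < n →
      v i ∈ C i ∧ ∀ j, i < j → j < n → Follows H R P i j (v i) (v j) := by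
    intro m
    induction m with
    -- At `t = n` no index remains, so the value `v₀` is arbitrary.
    | zero => exact fun t ht C _ => ⟨fun _ => v₀, fun i hti hi => by omega⟩
    | succ m ih =>
      intro t ht C hC
      obtain ⟨x, hx, C', hC', hf⟩ :=
        hC.exists_next (H := H) hA hP hPR hRP hρ hδ hρδ hδn (by omega) hL hL0 hN1 hN2
      obtain ⟨v, hv⟩ := ih (t + 1) (by omega) C' hC'
      have hv' : ∀ i, t < i → Function.update v t x i = v i := fun i hi =>
        Function.update_of_ne (by omega) _ _
      refine ⟨Function.update v t x, fun i hti hi => ?_⟩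
      rcases hti.eq_or_lt with rfl | hti
      · rw [Function.update_self]
        refine ⟨hx, fun j hj hjn => ?_⟩
        rw [hv' j hj]
        exact (hf j hj hjn _ (hv j hj hjn).1).2
      · rw [hv' i hti]
        refine ⟨(hf i hti hi _ (hv i hti hi).1).1, fun j hj hjn => ?_⟩
        rw [hv' j (by omega)]
        exact (hv i hti hi).2 j hj hjn
  have h0 : Candidates B ρ n A l 0 A := by
    refine ⟨fun _ _ _ => Finset.Subset.refl _, fun j _ _ => by simp, fun j k _ hj hk hl x hx => ?_⟩
    simpa using hA.sparse j k hj hk hl x hx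
  obtain ⟨v, hv⟩ := key n 0 (by omega) A h0
  exact ⟨v, fun i j hij hj => (hv i (by omega) (by omega)).2 j hij hj⟩

/-! ### Choice of parameters and conclusion -/

/-- With `n = 2 ^ r`, `κ` is `2 ^ (2 * n + 2 + r)`. Apart from the first factor `L`, all exponents
sum to `O(r * n)` and fit into `40 * r * n`. -/
lemma size_bound (r : ℕ) (hr : 1 ≤ r) :
    (2 : ℝ) ^ (9 * (40 * r * 2 ^ r)) * (4 ^ 2 ^ r * (4 * ((2 ^ r : ℕ) : ℝ))) *
      (4 * (4 ^ 2 ^ r * (4 * ((2 ^ r : ℕ) : ℝ))) ^ 2) ^ r *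
      ((2 ^ (2 * r + 5) : ℝ)⁻¹)⁻¹ ^ (3 * 2 ^ r) ≤ 2 ^ (400 * r * 2 ^ r) := by
  have hn : r < 2 ^ r := Nat.lt_two_pow_self
  set n := 2 ^ r with hn'
  have hc : ((n : ℕ) : ℝ) = 2 ^ r := by rw [hn']; push_cast; rfl
  have hκ : (4 : ℝ) ^ n * (4 * (n : ℝ)) = 2 ^ (2 * n + 2 + r) := by
    rw [hc, show (4 : ℝ) = 2 ^ 2 by norm_num, ← pow_mul, ← pow_add, ← pow_add]
    congr 1
    ring
  rw [hκ, inv_inv, show (4 : ℝ) = 2 ^ 2 by norm_num]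
  simp only [← pow_mul, ← pow_add]
  refine pow_le_pow_right₀ (by norm_num) ?_
  nlinarith [Nat.mul_le_mul hr hn.le, Nat.mul_le_mul_left r hn.le, Nat.mul_le_mul_right n hr]

/-- Every graph on at most `2 ^ r` vertices has an induced Ramsey host on
`2 ^ (400 * r * 2 ^ r)` vertices. -/
theorem exists_isInducedRamsey {V : Type*} [Fintype V] (H : SimpleGraph V) (r : ℕ) (hr : 1 ≤ r)
    (hV : Fintype.card V ≤ 2 ^ r) :
    ∃ G : SimpleGraph (Fin (2 ^ (400 * r * 2 ^ r))), IsInducedRamsey H G := by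
  have hadamard := exists_hadamard (400 * r * 2 ^ r)
  obtain ⟨N, hN⟩ : ∃ N, N = 2 ^ (400 * r * 2 ^ r) := ⟨_, rfl⟩
  rw [← hN] at hadamard ⊢
  obtain ⟨s, hs, hs1, hs2⟩ := hadamard
  set P : Fin N → Fin N → Prop := fun x y => s x y = -1 with hPdef
  have hNc : (Fintype.card (Fin N) : ℝ) = 2 ^ (400 * r * 2 ^ r) := by
    rw [Fintype.card_fin, hN]
    push_cast
    rfl
  have hP : HasSecondMoment P := hasSecondMoment_of_hadamard s hs1 fun y z => by
    rw [hs2, hNc]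
    split_ifs <;> rfl
  let G : SimpleGraph (Fin N) :=
    { Adj := fun x y => x ≠ y ∧ P x y
      symm := ⟨fun x y h => ⟨h.1.symm, by simp only [hPdef]; rw [hs]; exact h.2⟩⟩
      loopless := ⟨fun x h => h.1 rfl⟩ }
  refine ⟨G, fun χ => ?_⟩
  let Q : Fin 2 → Fin N → Fin N → Prop := fun c x y => ∃ h : G.Adj x y, χ.get x y h = c
  have hQs : ∀ c x y, Q c x y → Q c y x := by
    rintro c x y ⟨h, hc⟩
    exact ⟨h.symm, by rw [← hc]; exact χ.get_comm _ _ _⟩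
  have hQP : ∀ c x y, Q c x y → P x y := fun c x y h => h.1.2
  have hPQ : ∀ c d : Fin 2, c ≠ d → ∀ x y, x ≠ y → P x y → Q c x y ∨ Q d x y := by
    intro c d hcd x y hxy hp
    have h : G.Adj x y := ⟨hxy, hp⟩
    have : χ.get x y h = c ∨ χ.get x y h = d := by omega
    exact this.imp (fun e => ⟨h, e⟩) fun e => ⟨h, e⟩
  have hn : r < 2 ^ r := Nat.lt_two_pow_self
  have hq : 4 * r + 30 ≤ 40 * r * 2 ^ r := by nlinarith
  set q := 40 * r * 2 ^ r with hqdef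
  have hq10 : 400 * r * 2 ^ r = 10 * q := by rw [hqdef]; ring
  -- With `n = 2 ^ r`, `ρ = 1 / (32 n²)` and `δ = 1 / (16 n)` make `2 n ρ ≤ δ` and `16 n δ ≤ 1`
  -- equalities. The choice `L = N ^ (9 / 10)` keeps `L ^ 3` far above `N ^ 2`, while `N / L = 2 ^
  -- q` pays for the block system.
  set ρ : ℝ := (2 ^ (2 * r + 5))⁻¹ with hρdef
  set δ : ℝ := (2 ^ (r + 4))⁻¹ with hδdef
  have hρ : 0 < ρ := by positivity
  have hδ : 0 < δ := by positivity
  have hρ1 : ρ ≤ 1 := inv_le_one_of_one_le₀ (one_le_pow₀ (by norm_num))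
  have hcast : ((2 ^ r : ℕ) : ℝ) = 2 ^ r := by push_cast; rfl
  have finish : ∀ c d : Fin 2, c ≠ d →
      HasBlockSystem (Q c) (Q d) ρ (ρ * (2 ^ r : ℕ)) (4 ^ 2 ^ r * (4 * (2 ^ r : ℕ)))
        (2 ^ (9 * q)) (2 ^ r) Finset.univ →
      ∃ f : H ↪g G, ∃ q : Fin 2, ∀ (u v : V) (h : H.Adj u v),
        χ.get (f u) (f v) (f.map_adj_iff.mpr h) = q := by
    rintro c d hcd ⟨A, l, w, τ, hA, -⟩
    let e := Fintype.equivFin V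
    -- The pattern is padded to `2 ^ r` indices; those not coming from `V` are isolated.
    let H' : ℕ → ℕ → Prop := fun i j => ∃ u v, (e u : ℕ) = i ∧ (e v : ℕ) = j ∧ H.Adj u v
    have hH' : ∀ u v, H' (e u) (e v) ↔ H.Adj u v := by
      refine fun u v => ⟨?_, fun h => ⟨u, v, rfl, rfl, h⟩⟩
      rintro ⟨u', v', hu, hv, h⟩
      rw [e.injective (Fin.ext hu), e.injective (Fin.ext hv)] at h
      exact h
    obtain ⟨v, hv⟩ := hA.exists_embedding (δ := δ) H' hP (hPQ c d hcd) (hQP c) hρ hδ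
      (by
        rw [hcast, hρdef, hδdef, ← div_eq_mul_inv, div_le_iff₀ (by positivity), ← div_eq_inv_mul,
          le_div_iff₀ (by positivity), ← pow_succ', ← pow_add]
        exact pow_le_pow_right₀ (by norm_num) (by omega))
      (by
        rw [hcast, hδdef, ← div_eq_mul_inv, div_le_iff₀ (by positivity), one_mul, pow_add]
        norm_num [mul_comm])
      (by
        rw [hρdef, ← div_eq_inv_mul, le_div_iff₀ (by positivity), show (4 : ℝ) = 2 ^ 2 by norm_num,
          ← pow_add]
        exact pow_le_pow_right₀ (by norm_num) (by omega))
      (by positivity)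
      (by
        rw [hNc, hδdef, hq10, inv_pow, ← div_eq_inv_mul, le_div_iff₀ (by positivity), ← pow_mul,
          ← pow_mul, ← pow_add]
        exact pow_le_pow_right₀ (by norm_num) (by omega))
      (by
        rw [hNc, hδdef, hρdef, hq10, hcast, ← mul_inv, inv_pow, ← mul_inv, ← div_eq_inv_mul,
          le_div_iff₀ (by positivity), show (4 : ℝ) = 2 ^ 2 by norm_num]
        simp only [← pow_mul, ← pow_add]
        exact pow_le_pow_right₀ (by norm_num) (by omega))
      ⟨0, by rw [hN]; positivity⟩
    have hlt : ∀ u : V, (e u : ℕ) < 2 ^ r := fun u => (e u).2.trans_le hV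
    have hpair : ∀ u u' : V, u ≠ u' → v (e u) ≠ v (e u') ∧
        (H.Adj u u' → Q c (v (e u)) (v (e u'))) ∧
        (¬ H.Adj u u' → ¬ P (v (e u)) (v (e u'))) := by
      intro u u' hne
      rcases lt_or_gt_of_ne (fun h => hne (e.injective (Fin.ext h)) : (e u : ℕ) ≠ e u') with h | h
      · have := hv _ _ h (hlt u')
        rwa [Follows, hH'] at this
      · obtain ⟨h1, h2, h3⟩ := hv _ _ h (hlt u)
        rw [hH', H.adj_comm] at h2 h3
        refine ⟨h1.symm, fun h => hQs _ _ _ (h2 h), fun h hp => h3 h ?_⟩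
        simp only [hPdef] at hp ⊢
        rw [hs]
        exact hp
    have hadj : ∀ u u', G.Adj (v (e u)) (v (e u')) ↔ H.Adj u u' := by
      intro u u'
      by_cases hu : u = u'
      · subst hu
        simp
      obtain ⟨h1, h2, h3⟩ := hpair u u' hu
      refine ⟨fun h => ?_, fun h => (h2 h).1⟩
      by_contra hcon
      exact h3 hcon h.2
    refine ⟨⟨⟨fun u => v (e u), fun u u' h => ?_⟩, fun {u u'} => hadj u u'⟩, c, fun u u' h => ?_⟩
    · by_contra hne
      exact (hpair u u' hne).1 h
    · exact ((hpair u u' h.ne).2.1 h).2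
  have hκ : (1 : ℝ) ≤ 4 ^ 2 ^ r * (4 * (2 ^ r : ℕ)) := by
    refine one_le_mul_of_one_le_of_one_le (one_le_pow₀ (by norm_num)) ?_
    have : (1 : ℝ) ≤ (2 ^ r : ℕ) := by exact_mod_cast Nat.one_le_two_pow
    linarith
  rcases hasBlockSystem_or (R := Q 0) (B := Q 1) (β := ρ * (2 ^ r : ℕ)) (L := 2 ^ (9 * q))
    (hQs 0) (hQs 1) hρ hρ1 (by positivity) hκ (by positivity) r (by rw [hcast]) Finset.univ
    (by rw [Finset.card_univ, hNc]; exact size_bound r hr) with h | h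
  · exact finish 0 1 (by decide) h
  · exact finish 1 0 (by decide) h

/-- A graph on at most one vertex is induced Ramsey for itself. -/
lemma isInducedRamsey_of_subsingleton {V : Type*} [Fintype V] (H : SimpleGraph V)
    (hV : Fintype.card V ≤ 1) : ∃ G : SimpleGraph (Fin 1), IsInducedRamsey H G := by
  have := Fintype.card_le_one_iff_subsingleton.1 hV
  exact ⟨⊥, fun χ => ⟨⟨⟨fun _ => 0, fun a b _ => Subsingleton.elim a b⟩,
    fun {a b} => by simp [Subsingleton.elim a b]⟩, 0,
    fun u v h => absurd (Subsingleton.elim u v) h.ne⟩⟩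

theorem mainTheorem3 :
    ∃ c : ℝ, ∀ (n : ℕ) (V : Type*) [Fintype V] (H : SimpleGraph V), Fintype.card V = n →
      (inducedRamseySet H).Nonempty ∧
        (inducedRamseyNumber H : ℝ) ≤ (2 : ℝ) ^ (c * (n : ℝ) * Real.logb 2 (n : ℝ)) := by
  -- `1600 = 400 * 2 * 2`, from `r ≤ 2 * logb 2 n` and `2 ^ r ≤ 2 * n`.
  refine ⟨1600, fun n V _ H hn => ?_⟩
  rcases Nat.lt_or_ge 1 n with h1 | h1
  · set r := Nat.clog 2 n with hr
    have hr1 : 1 ≤ r := Nat.clog_pos (by norm_num) h1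
    have hle : n ≤ 2 ^ r := Nat.le_pow_clog (by norm_num) n
    have hlt : 2 ^ (r - 1) < n := Nat.pow_pred_clog_lt_self (by norm_num) h1
    obtain ⟨G, hG⟩ := exists_isInducedRamsey H r hr1 (hn ▸ hle)
    refine ⟨⟨_, G, hG⟩, ?_⟩
    have hle' : (inducedRamseyNumber H : ℝ) ≤ (2 ^ (400 * r * 2 ^ r) : ℕ) := by
      exact_mod_cast Nat.sInf_le (⟨G, hG⟩ : 2 ^ (400 * r * 2 ^ r) ∈ inducedRamseySet H)
    refine hle'.trans ?_
    push_cast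
    rw [← Real.rpow_natCast]
    refine Real.rpow_le_rpow_of_exponent_le (by norm_num) ?_
    have hn2 : (2 : ℝ) ≤ n := by exact_mod_cast h1
    have hlog1 : 1 ≤ Real.logb 2 n := by
      rw [Real.le_logb_iff_rpow_le (by norm_num) (by linarith), Real.rpow_one]
      exact hn2
    have hlog : (r : ℝ) - 1 ≤ Real.logb 2 n := by
      rw [Real.le_logb_iff_rpow_le (by norm_num) (by linarith)]
      have : ((r : ℝ) - 1) = ((r - 1 : ℕ) : ℝ) := by
        rw [Nat.cast_sub hr1, Nat.cast_one]
      rw [this, Real.rpow_natCast]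
      exact_mod_cast hlt.le
    have hp : (2 : ℝ) ^ r ≤ 2 * n := by
      have : 2 ^ r = 2 * 2 ^ (r - 1) := by
        rw [← pow_succ']
        congr 1
        omega
      exact_mod_cast (by omega : 2 ^ r ≤ 2 * n)
    push_cast
    calc (400 : ℝ) * r * 2 ^ r ≤ 400 * (2 * Real.logb 2 n) * (2 * n) := by
          gcongr
          linarith
      _ = 1600 * n * Real.logb 2 n := by ring
  · obtain ⟨G, hG⟩ := isInducedRamsey_of_subsingleton H (hn ▸ h1)
    refine ⟨⟨_, G, hG⟩, ?_⟩
    have hle : (inducedRamseyNumber H : ℝ) ≤ 1 := by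
      exact_mod_cast Nat.sInf_le (⟨G, hG⟩ : 1 ∈ inducedRamseySet H)
    -- For `n ≤ 1` the exponent is 0 (with `Real.logb 2 0 = 0`), so a one-vertex host is just
    -- enough.
    refine hle.trans (Real.one_le_rpow (by norm_num) ?_)
    interval_cases n <;> simp
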